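/- Notation. For irrational $\omega>0$ let $(p_k/q_k)_{k\ge 0}$ be the convergents of its continued fraction; $\omega$ is a Bruno number if it is irrational and $\sum_{k\ge0}\frac{\log q_{k+1}}{q_k}<\infty$. The Bruno function is $B(\omega)=\sum_{n\ge0}x_0x_1\cdots x_{n-1}\log\frac1{x_n}$, where $x_0=\omega-\lfloor\omega\rfloor$ and $x_{n+1}=\frac1{x_n}-\lfloor\frac1{x_n}\rfloor$. For $\omega>0$ let $\mathcal F_\omega$ be the family of analytic vector fields $\mathbf F:\mathbb D\times\mathbb D\to\mathbb C^2$ of the form $$F_1(z_1,z_2)=-z_1+\sum_{|\alpha|\ge2}f_{\alpha,1}z^\alpha,\qquad F_2(z_1,z_2)=\omega z_2+\sum_{|\alpha|\ge2}f_{\alpha,2}z^\alpha,$$ with $|f_{\alpha,j}|\le1$ for all $|\alpha|\ge2$ and $j=1,2$. With $A=\mathrm{diag}(-1,\omega)$, a linearization of $\mathbf F\in\mathcal F_\omega$ is a formal power series $\mathbf H(w)=w+\mathbf h(w)$ from $\mathbb C^2$ to $\mathbb C^2$, with $\mathbf h$ of order at least $2$, such that the change of variables $z=\mathbf H(w)$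 transforms $\dot z=\mathbf F(z)$ into $\dot w=Aw$, that is $D\mathbf H(w)\,Aw=\mathbf F(\mathbf H(w))$. Let $d_{\mathbf F}\in[0,\infty]$ be the Euclidean distance from $0$ to the boundary of the Reinhardt domain of convergence of $\mathbf H$ (the interior of the set of points where $\mathbf H$ converges absolutely), with $d_{\mathbf F}=0$ if this domain does not contain $0$ and $d_{\mathbf F}=\infty$ if it is all of $\mathbb C^2$. Let $d_\omega=\inf_{\mathbf F\in\mathcal F_\omega}d_{\mathbf F}$. Theorem (Lower bound on $d_\omega$). For every Bruno number $\omega>0$, every $\mathbf F\in\mathcal F_\omega$ has exactly one linearization, so that $d_{\mathbf F}$ and $d_\omega$ are well defined. Moreover there is a universal constant $C$ (independent of $\omega$) such that, for every Bruno number $\omega>0$, $$\log d_\omega\ \ge\ -B(\omega)-C .$$ -/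

import Mathlib

open scoped ENNReal

noncomputable section

/-! ### Bruno numbers and the Bruno function -/

/-- The denominator `q_k` of the `k`-th convergent `p_k / q_k` of the (regular) continued fraction
expansion of `ω`, with `q_0 = 1` and `q_1 = a_1`. -/
def convergentDen (ω : ℝ) (k : ℕ) : ℝ := (GenContFract.of ω).dens k

/-- `ω` is a Bruno number: it is irrational and `∑_k log q_{k+1} / q_k < ∞`. -/
def IsBrunoNumber (ω : ℝ) : Prop :=
  Irrational ω ∧
    Summable fun k : ℕ => Real.log (convergentDen ω (k + 1)) / convergentDen ω k

/-- The orbit of the Gauss map: `x_0 = ω - ⌊ω⌋` and `x_{n+1} = 1 / x_n - ⌊1 / x_n⌋`. -/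
def gaussOrbit (ω : ℝ) : ℕ → ℝ
  | 0 => Int.fract ω
  | n + 1 => Int.fract (1 / gaussOrbit ω n)

/-- The Bruno function `B(ω) = ∑_{n ≥ 0} x_0 x_1 ⋯ x_{n-1} log (1 / x_n)`, with values in `[0, ∞]`.
For irrational `ω` every `x_n` lies in `(0, 1)`, so that all the terms are positive. It is
`1`-periodic and satisfies `B(x) = - log x + x B(1 / x)` for irrational `x` in `(0, 1)`. -/
def brunoFunction (ω : ℝ) : ℝ≥0∞ :=
  ∑' n : ℕ, ENNReal.ofReal
    ((∏ i ∈ Finset.range n, gaussOrbit ω i) * Real.log (1 / gaussOrbit ω n))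

/-! ### Vector fields of `ℂ²` and their linearizations -/

/-- Formal power series in `(z₁, z₂)` with coefficients in `ℂ²`, given by their two components. -/
abbrev FormalMap : Type := Fin 2 → MvPowerSeries (Fin 2) ℂ

/-- The eigenvalues `(-1, ω)` of the linear part `A = diag(-1, ω)`. -/
def eigenvalues (ω : ℝ) : Fin 2 → ℂ := ![-1, (ω : ℂ)]

/-- The family of vector fields `F(z) = (-z₁ + ∑_{|α| ≥ 2} f_{α,1} z^α, ω z₂ + ∑_{|α| ≥ 2} f_{α,2} z^α)`
with `|f_{α,j}| ≤ 1` for all `|α| ≥ 2` and `j = 1, 2`. An element is given by its power series, which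
converges on the unit polydisk because of the bound on the coefficients. -/
def vectorFieldFamily (ω : ℝ) : Set FormalMap :=
  {F | (∀ j, MvPowerSeries.coeff 0 (F j) = 0) ∧
    (∀ i j, MvPowerSeries.coeff (Finsupp.single i 1) (F j) =
      if i = j then eigenvalues ω j else 0) ∧
    ∀ (α : Fin 2 →₀ ℕ) (j : Fin 2), 2 ≤ α.degree → ‖MvPowerSeries.coeff α (F j)‖ ≤ 1}

/-- `H(w) = w + h(w)`, with `h` of order at least `2`, is a linearization of the vector field `F`
with linear part `A = diag(-1, ω)`: the change of variables `z = H(w)` transforms `ż = F(z)` into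
`ẇ = A w`, that is `DH(w) (A w) = F(H(w))`. -/
structure IsLinearization (ω : ℝ) (F H : FormalMap) : Prop where
  coeff_zero : ∀ j, MvPowerSeries.coeff 0 (H j) = 0
  coeff_one : ∀ i j, MvPowerSeries.coeff (Finsupp.single i 1) (H j) = if i = j then 1 else 0
  conj : ∀ j, ∑ i, (eigenvalues ω i • MvPowerSeries.X i) * MvPowerSeries.pderiv ℂ i (H j) =
    MvPowerSeries.subst H (F j)

/-! ### Reinhardt domain of convergence and distance to its boundary -/

/-- The domain of convergence of a power series `H` of `ℂ²`, a complete Reinhardt domain centred at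
`0` when not empty: the interior of the set of points at which `∑_α H_α z^α` converges absolutely.
`ℂ²` carries the Hermitian norm `(|z₁|² + |z₂|²)^{1/2}`. -/
def reinhardtDomain (H : FormalMap) : Set (EuclideanSpace ℂ (Fin 2)) :=
  interior {z | ∀ j, Summable fun α : Fin 2 →₀ ℕ =>
    ‖MvPowerSeries.coeff α (H j) * ∏ i, z i ^ α i‖}

open Classical in
/-- The distance from `0` to the boundary of the domain of convergence of `H`. It is `∞` if the
series converges everywhere, and `0` if it diverges, that is if the domain does not contain `0`. -/
def boundaryDistance (H : FormalMap) : ℝ≥0∞ :=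
  if (0 : EuclideanSpace ℂ (Fin 2)) ∈ reinhardtDomain H then
    Metric.infEDist 0 (frontier (reinhardtDomain H))
  else 0

/-- `d_ω`: the infimum, over the vector fields `F` of the family, of the distance from `0` to the
boundary of the domain of convergence of the linearization of `F`. -/
def dOmega (ω : ℝ) : ℝ≥0∞ :=
  ⨅ (F : FormalMap) (_ : F ∈ vectorFieldFamily ω) (H : FormalMap) (_ : IsLinearization ω F H),
    boundaryDistance H

end

/-! Write `F_j = λ_j z_j + f_j` with `f_j` of order at least 2. Comparing coefficients, `H` is a
linearization iff `(⟨λ,α⟩ - λ_j) H_{j,α} = [f_j(H)]_α` for `|α| ≥ 2`, with `H = w + ⋯`. The right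
side involves only coefficients of `H` of degree below `|α|`, and the divisor is `n ω - m` with `m +
n = |α| - 1 ≥ 1`, nonzero for irrational `ω`. Hence existence and uniqueness
(`existsUnique_linearization`).

For the radius, the coefficients are compared with `e^{K(|α|-1)}` times a geometric factor. Two
properties of `K` suffice: superadditivity, so that products can be estimated, and `K(d) - log|n ω -
m| ≤ K(d+1)` when `m + n = d + 1`, so that dividing by the divisor is absorbed
(`divisorWeight_sub_log_le`). A majorant argument with numerical constants then applies
(`weightedBound_linearization`).

`K` is built scale by scale: at scale `k` one counts how often divisors below `x_0 ⋯ x_{k-1} / 4`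
can be met, each with weight `log (1 / x_k)`. The values `m + n` of such divisors are sparse: over
distances up to `E = Q / (2 x_k)` they differ by multiples of `Q = p + q`, the sum attached to a
convergent. So at most `n x_0 ⋯ x_{k-1} (1 + 17 x_k)` are met (`maxCount_smallDivisorSet_le`), and
summing over `k` gives `K(n) ≤ n (B(ω) + const)` (`divisorWeight_le`). -/

/-! ### Combinatorics: counting visits to a sparse set. -/

/-- `SmallCount A n c`: in a splitting process starting from `n`, in which an element is split into
two parts or decreased by one, the elements of `A` that are decreased by one may be met `c` times. -/
inductive SmallCount (A : Set ℕ) : ℕ → ℕ → Prop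
  | zero (n : ℕ) : SmallCount A n 0
  | add {a b c d : ℕ} : SmallCount A a c → SmallCount A b d → SmallCount A (a + b) (c + d)
  | step {n c : ℕ} : SmallCount A n c → n + 1 ∈ A → SmallCount A (n + 1) (c + 1)

lemma le_sub_three_of_le_add_one {Q n : ℕ} {E : ℝ} (hE : 0 < E) (h : E ≤ n) (c : ℝ)
    (hc : c ≤ (n : ℝ) / Q + 1) : c ≤ (n : ℝ) / Q + 4 * n / E - 3 := by
  have : 1 ≤ (n : ℝ) / E := by rwa [le_div_iff₀ hE, one_mul]
  have h2 : 4 * (n : ℝ) / E = 4 * (n / E) := by ring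
  rw [h2]; linarith

lemma Nat.cast_pred_div_add_one_le {Q n : ℕ} (hQ : 0 < Q) (hn : 0 < n) (h : Q ∣ n) :
    (((n - 1) / Q : ℕ) : ℝ) + 1 ≤ (n : ℝ) / Q := by
  obtain ⟨t, rfl⟩ := h
  have ht : 0 < t := Nat.pos_of_mul_pos_left hn
  have h1 : (Q * t - 1) / Q < t := Nat.div_lt_of_lt_mul (by omega)
  have h2 : (((Q * t - 1) / Q : ℕ) : ℝ) + 1 ≤ t := by exact_mod_cast h1
  have hQ' : (Q : ℝ) ≠ 0 := by positivity
  push_cast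
  rwa [mul_div_cancel_left₀ _ hQ']

/-- The bound `n/Q + 4n/E` is strengthened so that induction closes. Below `E` only multiples of `Q`
are counted, hence the integer part. Above `E`, `m` is the last counted element on a large branch;
keeping an integer part of `(n - m)/Q` makes the next counted element free when it lies within `E`
of `m`, since the gap is then a multiple of `Q`. A gap larger than `E` is paid by `4n/E`. -/
lemma SmallCount.invariant {A : Set ℕ} {Q : ℕ} {E : ℝ} (hQ : 0 < Q) (hE : 0 < E)
    (hA0 : ∀ n ∈ A, (n : ℝ) ≤ E → Q ∣ n)
    (hA : ∀ m ∈ A, ∀ n ∈ A, m < n → (n : ℝ) - m ≤ E → Q ∣ n - m) {n c : ℕ}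
    (h : SmallCount A n c) :
    ((n : ℝ) < E → c ≤ n / Q) ∧ (E ≤ n → ((c : ℝ) ≤ (n : ℝ) / Q + 4 * n / E - 3 ∨
      ∃ m ∈ A, m ≤ n ∧ (c : ℝ) ≤ (m : ℝ) / Q + 4 * m / E - 2 + ((n - m) / Q : ℕ))) := by
  have hQ' : (0 : ℝ) < Q := by exact_mod_cast hQ
  have weak : ∀ {n c : ℕ}, ((c : ℝ) ≤ (n : ℝ) / Q + 4 * n / E - 3 ∨
      ∃ m ∈ A, m ≤ n ∧ (c : ℝ) ≤ (m : ℝ) / Q + 4 * m / E - 2 + ((n - m) / Q : ℕ)) →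
      (c : ℝ) ≤ (n : ℝ) / Q + 4 * n / E - 2 := by
    rintro n c (h | ⟨m, -, hmn, h⟩)
    · linarith
    · have h1 : (((n - m) / Q : ℕ) : ℝ) ≤ ((n - m : ℕ) : ℝ) / Q := Nat.cast_div_le
      rw [Nat.cast_sub hmn, sub_div] at h1
      have h2 : (4 * m / E : ℝ) ≤ 4 * n / E := by gcongr
      linarith
  have mixed : ∀ {a b c d : ℕ}, ((c : ℝ) ≤ (a : ℝ) / Q + 4 * a / E - 3 ∨
      ∃ m ∈ A, m ≤ a ∧ (c : ℝ) ≤ (m : ℝ) / Q + 4 * m / E - 2 + ((a - m) / Q : ℕ)) →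
      d ≤ b / Q → (((c + d : ℕ) : ℝ) ≤ ((a + b : ℕ) : ℝ) / Q + 4 * (a + b : ℕ) / E - 3 ∨
      ∃ m ∈ A, m ≤ a + b ∧ ((c + d : ℕ) : ℝ) ≤
        (m : ℝ) / Q + 4 * m / E - 2 + ((a + b - m) / Q : ℕ)) := by
    rintro a b c d (h | ⟨m, hm, hma, h⟩) hd
    · left
      have h1 : (d : ℝ) ≤ (b : ℝ) / Q := le_trans (by exact_mod_cast hd) Nat.cast_div_le
      have h2 : (0 : ℝ) ≤ 4 * b / E := by positivity
      push_cast
      rw [add_div, mul_add, add_div]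
      linarith
    · right
      refine ⟨m, hm, by omega, ?_⟩
      have h1 : (a - m) / Q + d ≤ (a + b - m) / Q := by
        calc (a - m) / Q + d ≤ (a - m) / Q + b / Q := by omega
          _ ≤ (a - m + b) / Q := Nat.div_add_div_le_add_div
          _ = _ := by congr 1; omega
      have h2 : (((a - m) / Q : ℕ) : ℝ) + d ≤ ((a + b - m) / Q : ℕ) := by exact_mod_cast h1
      push_cast at h2 ⊢
      linarith
  induction h with
  | zero n =>
    refine ⟨fun _ => Nat.zero_le _, fun h => Or.inl ?_⟩
    exact le_sub_three_of_le_add_one hE h _ (by push_cast; positivity)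
  | @add a b c d _ _ iha ihb =>
    rcases lt_or_ge (a : ℝ) E with ha | ha <;> rcases lt_or_ge (b : ℝ) E with hb | hb
    · have hcd : c + d ≤ (a + b) / Q :=
        (Nat.add_le_add (iha.1 ha) (ihb.1 hb)).trans (Nat.div_add_div_le_add_div)
      refine ⟨fun _ => hcd, fun h => Or.inl ?_⟩
      refine le_sub_three_of_le_add_one hE h _ ?_
      have : ((c + d : ℕ) : ℝ) ≤ ((a + b : ℕ) : ℝ) / Q :=
        le_trans (by exact_mod_cast hcd) Nat.cast_div_le
      linarith
    · refine ⟨fun h => absurd h (not_lt.2 (hb.trans (by push_cast; simp))), fun _ => ?_⟩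
      rw [add_comm a b, add_comm c d]
      exact mixed (ihb.2 hb) (iha.1 ha)
    · refine ⟨fun h => absurd h (not_lt.2 (ha.trans (by push_cast; simp))), fun _ => ?_⟩
      exact mixed (iha.2 ha) (ihb.1 hb)
    -- Two large branches merge: each has slack 2, and a total slack of 4 covers the required 3, so
    -- no marked element `m` is needed.
    · refine ⟨fun h => absurd h (not_lt.2 (hb.trans (by push_cast; simp))), fun _ => Or.inl ?_⟩
      have h1 := weak (iha.2 ha)
      have h2 := weak (ihb.2 hb)
      push_cast
      rw [add_div, mul_add, add_div]
      linarith
  | @step n c _ hn ih =>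
    constructor
    · intro h
      have h1 := ih.1 (lt_trans (by push_cast; linarith) h)
      have h2 := Nat.cast_pred_div_add_one_le hQ n.succ_pos (hA0 _ hn h.le)
      have h3 : n / Q + 1 ≤ (n + 1) / Q := by
        rw [Nat.le_div_iff_mul_le hQ, ← Nat.cast_le (α := ℝ)]
        rw [le_div_iff₀ hQ'] at h2
        simpa using h2
      omega
    · intro h
      rcases lt_or_ge (n : ℝ) E with hnE | hnE
      · left
        refine le_sub_three_of_le_add_one hE h _ ?_
        have h1 : (c : ℝ) ≤ (n : ℝ) / Q :=
          le_trans (by exact_mod_cast ih.1 hnE) Nat.cast_div_le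
        push_cast
        rw [add_div]
        have : (0 : ℝ) < 1 / Q := by positivity
        linarith
      · right
        -- The element just counted becomes the new mark.
        refine ⟨n + 1, hn, le_rfl, ?_⟩
        have e1 : (0 : ℝ) < 1 / Q := by positivity
        have e2 : (0 : ℝ) < 4 / E := by positivity
        rcases ih.2 hnE with h1 | ⟨m, hm, hmn, h1⟩
        · push_cast
          rw [add_div, mul_add, add_div, mul_one]
          simp only [Nat.sub_self, Nat.zero_div, Nat.cast_zero]
          linarith
        · have key : (((n - m) / Q : ℕ) : ℝ) + 1 ≤
              ((n + 1 : ℕ) - m : ℝ) / Q + 4 * ((n + 1 : ℕ) - m : ℝ) / E := by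
            rw [← Nat.cast_sub (by omega : m ≤ n + 1)]
            rcases le_or_gt (((n + 1 : ℕ) : ℝ) - m) E with h2 | h2
            · have h3 := Nat.cast_pred_div_add_one_le hQ (by omega : 0 < n + 1 - m)
                (hA m hm _ hn (by omega) h2)
              rw [show n + 1 - m - 1 = n - m by omega] at h3
              have : (0 : ℝ) ≤ 4 * ((n + 1 - m : ℕ) : ℝ) / E := by positivity
              linarith
            · have h3 : (((n - m) / Q : ℕ) : ℝ) ≤ ((n + 1 - m : ℕ) : ℝ) / Q :=
                le_trans Nat.cast_div_le (by gcongr; omega)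
              rw [← Nat.cast_sub (by omega : m ≤ n + 1)] at h2
              have h4 : 1 ≤ 4 * ((n + 1 - m : ℕ) : ℝ) / E := by
                rw [le_div_iff₀ hE]; linarith
              linarith
          rw [sub_div, mul_sub, sub_div] at key
          simp only [Nat.sub_self, Nat.zero_div, Nat.cast_zero]
          rw [Nat.cast_add c 1, Nat.cast_one]
          linarith

lemma SmallCount.le {A : Set ℕ} {Q : ℕ} {E : ℝ} (hQ : 0 < Q) (hE : 0 < E)
    (hA0 : ∀ n ∈ A, (n : ℝ) ≤ E → Q ∣ n)
    (hA : ∀ m ∈ A, ∀ n ∈ A, m < n → (n : ℝ) - m ≤ E → Q ∣ n - m) {n c : ℕ}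
    (h : SmallCount A n c) : (c : ℝ) ≤ (n : ℝ) / Q + 4 * n / E := by
  obtain ⟨h1, h2⟩ := h.invariant hQ hE hA0 hA
  have hp : (0 : ℝ) ≤ 4 * n / E := by positivity
  rcases lt_or_ge (n : ℝ) E with hn | hn
  · have : (c : ℝ) ≤ (n : ℝ) / Q := le_trans (by exact_mod_cast h1 hn) Nat.cast_div_le
    linarith
  · rcases h2 hn with h | ⟨m, -, hmn, h⟩
    · linarith
    · have h1 : (((n - m) / Q : ℕ) : ℝ) ≤ ((n - m : ℕ) : ℝ) / Q := Nat.cast_div_le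
      rw [Nat.cast_sub hmn, sub_div] at h1
      have h2 : (4 * m / E : ℝ) ≤ 4 * n / E := by gcongr
      linarith

/-- The largest `c` with `SmallCount A n c`. -/
noncomputable def maxCount (A : Set ℕ) (n : ℕ) : ℕ := sSup {c | SmallCount A n c}

lemma smallCount_le_self {A : Set ℕ} {n c : ℕ} (h : SmallCount A n c) : c ≤ n := by
  induction h with
  | zero => omega
  | add => omega
  | step => omega

lemma bddAbove_smallCount (A : Set ℕ) (n : ℕ) : BddAbove {c | SmallCount A n c} :=
  ⟨n, fun _ h => smallCount_le_self h⟩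

lemma smallCount_maxCount (A : Set ℕ) (n : ℕ) : SmallCount A n (maxCount A n) :=
  Nat.sSup_mem ⟨0, SmallCount.zero n⟩ (bddAbove_smallCount A n)

lemma SmallCount.le_maxCount {A : Set ℕ} {n c : ℕ} (h : SmallCount A n c) : c ≤ maxCount A n :=
  le_csSup (bddAbove_smallCount A n) h

lemma maxCount_add_le (A : Set ℕ) (m n : ℕ) :
    maxCount A m + maxCount A n ≤ maxCount A (m + n) :=
  ((smallCount_maxCount A m).add (smallCount_maxCount A n)).le_maxCount

lemma maxCount_succ_le {A : Set ℕ} {n : ℕ} (h : n + 1 ∈ A) :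
    maxCount A n + 1 ≤ maxCount A (n + 1) :=
  ((smallCount_maxCount A n).step h).le_maxCount

/-! ### Continued fractions: sparsity of the small divisors at each scale. -/

section GaussMap

variable {ω : ℝ}

lemma irrational_gaussOrbit (h : Irrational ω) (n : ℕ) : Irrational (gaussOrbit ω n) := by
  induction n with
  | zero => exact h.sub_intCast _
  | succ n ih =>
    rw [gaussOrbit, one_div]
    exact ih.inv.sub_intCast _

lemma gaussOrbit_pos (h : Irrational ω) (n : ℕ) : 0 < gaussOrbit ω n := by
  have h0 := (irrational_gaussOrbit h n).ne_zero
  have h1 : 0 ≤ gaussOrbit ω n := by cases n <;> exact Int.fract_nonneg _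
  exact lt_of_le_of_ne h1 h0.symm

lemma gaussOrbit_lt_one (n : ℕ) : gaussOrbit ω n < 1 := by
  cases n <;> exact Int.fract_lt_one _

/-- The partial products `x_0 x_1 ⋯ x_{n-1}` of the orbit of the Gauss map. -/
noncomputable def gaussProd (ω : ℝ) (n : ℕ) : ℝ := ∏ i ∈ Finset.range n, gaussOrbit ω i

lemma gaussProd_succ (n : ℕ) : gaussProd ω (n + 1) = gaussProd ω n * gaussOrbit ω n :=
  Finset.prod_range_succ _ _

lemma gaussProd_zero : gaussProd ω 0 = 1 := rfl

lemma gaussProd_pos (h : Irrational ω) (n : ℕ) : 0 < gaussProd ω n :=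
  Finset.prod_pos fun i _ => gaussOrbit_pos h i

lemma gaussProd_succ_le (h : Irrational ω) (n : ℕ) : gaussProd ω (n + 1) ≤ gaussProd ω n := by
  rw [gaussProd_succ]
  exact mul_le_of_le_one_right (gaussProd_pos h n).le (gaussOrbit_lt_one n).le

lemma gaussProd_add_two (h : Irrational ω) (n : ℕ) :
    gaussProd ω (n + 2) = gaussProd ω n - ⌊1 / gaussOrbit ω n⌋₊ * gaussProd ω (n + 1) := by
  have hx := gaussOrbit_pos h n
  rw [gaussProd_succ, gaussProd_succ, gaussOrbit, Int.fract,
    ← natCast_floor_eq_intCast_floor (by positivity)]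
  field_simp

lemma one_le_floor_inv_gaussOrbit (h : Irrational ω) (n : ℕ) : 1 ≤ ⌊1 / gaussOrbit ω n⌋₊ := by
  have hx := gaussOrbit_pos h n
  rw [Nat.one_le_floor_iff, le_div_iff₀ hx, one_mul]
  exact (gaussOrbit_lt_one n).le

lemma gaussProd_add_two_le (h : Irrational ω) (n : ℕ) :
    gaussProd ω (n + 2) ≤ gaussProd ω n / 2 := by
  have h1 := gaussProd_add_two h n
  have h2 := gaussProd_succ_le h (n + 1)
  have h3 : (1 : ℝ) ≤ ⌊1 / gaussOrbit ω n⌋₊ := by exact_mod_cast one_le_floor_inv_gaussOrbit h n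
  have h4 := le_mul_of_one_le_left (gaussProd_pos h (n + 1)).le h3
  linarith

lemma sum_gaussProd_le (h : Irrational ω) (n : ℕ) :
    ∑ i ∈ Finset.range n, gaussProd ω i ≤ 4 := by
  -- The subtracted terms make the induction telescope, because the products halve every two steps.
  suffices ∑ i ∈ Finset.range n, gaussProd ω i ≤
      4 - 2 * gaussProd ω n - 2 * gaussProd ω (n + 1) by
    linarith [gaussProd_pos h n, gaussProd_pos h (n + 1)]
  induction n with
  | zero =>
    have := gaussProd_succ_le h 0
    simp only [Finset.range_zero, Finset.sum_empty, gaussProd_zero] at this ⊢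
    linarith
  | succ n ih =>
    rw [Finset.sum_range_succ]
    linarith [gaussProd_add_two_le h n]

/-- The sums `p_k + q_k` of the numerators and the denominators of the convergents of `ω`,
shifted by one. -/
noncomputable def convergentSum (ω : ℝ) : ℕ → ℕ
  | 0 => 1
  | 1 => ⌊ω⌋₊ + 1
  | n + 2 => ⌊1 / gaussOrbit ω n⌋₊ * convergentSum ω (n + 1) + convergentSum ω n

lemma convergentSum_le_succ (h : Irrational ω) (n : ℕ) :
    convergentSum ω n ≤ convergentSum ω (n + 1) := by
  cases n with
  | zero => simp [convergentSum]
  | succ n =>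
    rw [convergentSum]
    exact le_add_right (Nat.le_mul_of_pos_left _ (one_le_floor_inv_gaussOrbit h n))

lemma convergentSum_pos (h : Irrational ω) (n : ℕ) : 0 < convergentSum ω n := by
  induction n with
  | zero => simp [convergentSum]
  | succ n ih => exact ih.trans_le (convergentSum_le_succ h n)

lemma gaussProd_mul_convergentSum (hω : 0 < ω) (h : Irrational ω) (n : ℕ) :
    gaussProd ω n * convergentSum ω (n + 1) + gaussProd ω (n + 1) * convergentSum ω n = 1 + ω := by
  induction n with
  | zero =>
    have := Int.floor_add_fract ω
    rw [← natCast_floor_eq_intCast_floor hω.le] at this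
    simp [gaussProd_zero, gaussProd_succ, convergentSum, gaussOrbit]
    linarith
  | succ n ih =>
    rw [gaussProd_add_two h, convergentSum, ← ih]
    push_cast
    ring

lemma inv_convergentSum_le (hω : 0 < ω) (h : Irrational ω) (n : ℕ) :
    1 / (convergentSum ω (n + 1) : ℝ) ≤ gaussProd ω n + gaussProd ω (n + 1) := by
  have h1 := gaussProd_mul_convergentSum hω h n
  have h2 : (convergentSum ω n : ℝ) ≤ convergentSum ω (n + 1) := by
    exact_mod_cast convergentSum_le_succ h n
  have h3 : (0 : ℝ) < convergentSum ω (n + 1) := by exact_mod_cast convergentSum_pos h (n + 1)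
  rw [div_le_iff₀ h3]
  have := mul_le_mul_of_nonneg_left h2 (gaussProd_pos h (n + 1)).le
  linarith

/-- Two consecutive convergent vectors `(p, q)` form a basis of `ℤ²`; `a` and `b` are the
coordinates of `(m, n)`. The values of `q ω - p` on this basis have opposite signs, whence the minus
sign. -/
lemma exists_decomposition (hω : 0 < ω) (h : Irrational ω) (k : ℕ) (m n : ℤ) :
    ∃ a b : ℤ, m + n = a * convergentSum ω (k + 1) + b * convergentSum ω k ∧
      |n * ω - m| = |a * gaussProd ω (k + 1) - b * gaussProd ω k| := by
  suffices ∃ a b : ℤ, m + n = a * convergentSum ω (k + 1) + b * convergentSum ω k ∧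
      n * ω - m = (-1) ^ k * (a * gaussProd ω (k + 1) - b * gaussProd ω k) by
    obtain ⟨a, b, h1, h2⟩ := this
    exact ⟨a, b, h1, by rw [h2, abs_mul, abs_pow]; simp⟩
  induction k with
  | zero =>
    have h1 := Int.floor_add_fract ω
    rw [← natCast_floor_eq_intCast_floor hω.le] at h1
    refine ⟨n, m - n * ⌊ω⌋₊, ?_, ?_⟩
    · simp only [convergentSum]; push_cast; ring
    · simp only [gaussProd_succ, gaussProd_zero, gaussOrbit]
      push_cast
      linear_combination (-n : ℝ) * h1
  | succ k ih =>
    obtain ⟨a, b, h1, h2⟩ := ih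
    refine ⟨b, a - b * ⌊1 / gaussOrbit ω k⌋₊, ?_, ?_⟩
    · rw [h1, convergentSum]; push_cast; ring
    · rw [h2, gaussProd_add_two h]; push_cast; ring

/-- The numbers `m + n` for which `|n ω - m|` is small with respect to `x_0 ⋯ x_{k-1}`. -/
def smallDivisorSet (ω : ℝ) (k : ℕ) : Set ℕ :=
  {d | ∃ m n : ℤ, m + n = d ∧ |n * ω - m| < gaussProd ω k / 4}

/-- The coordinate `b` must vanish. If `b < 0`, positivity of `m + n` forces `a > 0` and the two
parts of the divisor reinforce each other; if `b > 0`, the upper bound on `m + n` makes `a` too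
small to cancel more than half of `gaussProd ω k`. -/
lemma convergentSum_dvd (hω : 0 < ω) (h : Irrational ω) (k : ℕ) {m n : ℤ} (hpos : 0 < m + n)
    (hle : ((m + n : ℤ) : ℝ) ≤
      convergentSum ω (k + 1) * gaussProd ω k / (2 * gaussProd ω (k + 1)))
    (hs : |n * ω - m| < gaussProd ω k / 2) : (convergentSum ω (k + 1) : ℤ) ∣ m + n := by
  obtain ⟨a, b, h1, h2⟩ := exists_decomposition hω h k m n
  rw [h2] at hs
  have hb := gaussProd_pos h k
  have hb' := gaussProd_pos h (k + 1)
  have hQ : (0 : ℝ) < convergentSum ω (k + 1) := by exact_mod_cast convergentSum_pos h (k + 1)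
  have hD : (0 : ℝ) < convergentSum ω k := by exact_mod_cast convergentSum_pos h k
  have h1r : ((m + n : ℤ) : ℝ) = a * convergentSum ω (k + 1) + b * convergentSum ω k := by
    rw [h1]; push_cast; rfl
  have hposr : (0 : ℝ) < ((m + n : ℤ) : ℝ) := by exact_mod_cast hpos
  rw [abs_lt] at hs
  rcases lt_trichotomy b 0 with hneg | rfl | hbpos
  · have hbr : (b : ℝ) ≤ -1 := by exact_mod_cast (by omega : b ≤ -1)
    have ha : (0 : ℝ) < a := by
      by_contra! ha
      have e1 := mul_nonpos_of_nonpos_of_nonneg ha hQ.le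
      have e2 := mul_neg_of_neg_of_pos (by linarith : (b : ℝ) < 0) hD
      linarith
    have e1 := mul_pos ha hb'
    have e2 := mul_le_mul_of_nonneg_right hbr hb.le
    linarith
  · exact ⟨a, by rw [h1]; ring⟩
  · have hbr : (1 : ℝ) ≤ b := by exact_mod_cast hbpos
    have e2 := mul_le_mul_of_nonneg_right hbr hb.le
    have e3 : a * convergentSum ω (k + 1) ≤
        convergentSum ω (k + 1) * gaussProd ω k / (2 * gaussProd ω (k + 1)) := by
      have := mul_pos (by linarith : (0 : ℝ) < b) hD
      linarith
    rw [mul_comm (a : ℝ), mul_div_assoc, mul_le_mul_iff_right₀ hQ, le_div_iff₀ (by positivity)]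
      at e3
    linarith

lemma maxCount_smallDivisorSet_le (hω : 0 < ω) (h : Irrational ω) (k n : ℕ) :
    (maxCount (smallDivisorSet ω k) n : ℝ) ≤
      n * (gaussProd ω k * (1 + 17 * gaussOrbit ω k)) := by
  have hb := gaussProd_pos h k
  have hb' := gaussProd_pos h (k + 1)
  have hQ : (0 : ℝ) < convergentSum ω (k + 1) := by exact_mod_cast convergentSum_pos h (k + 1)
  have hx := gaussOrbit_pos h k
  have hx1 := (gaussOrbit_lt_one (ω := ω) k).le
  have h1 := (smallCount_maxCount (smallDivisorSet ω k) n).le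
    (Q := convergentSum ω (k + 1))
    (E := convergentSum ω (k + 1) * gaussProd ω k / (2 * gaussProd ω (k + 1)))
    (convergentSum_pos h (k + 1)) (by positivity) ?_ ?_
  · have e1 : (n : ℝ) / convergentSum ω (k + 1) +
        4 * n / (convergentSum ω (k + 1) * gaussProd ω k / (2 * gaussProd ω (k + 1))) =
        n * ((1 / convergentSum ω (k + 1)) * (1 + 8 * gaussOrbit ω k)) := by
      rw [gaussProd_succ]
      field_simp
      ring
    rw [e1] at h1
    refine h1.trans (mul_le_mul_of_nonneg_left ?_ n.cast_nonneg)
    calc _ ≤ (gaussProd ω k + gaussProd ω (k + 1)) * (1 + 8 * gaussOrbit ω k) :=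
          mul_le_mul_of_nonneg_right (inv_convergentSum_le hω h k) (by positivity)
      _ = gaussProd ω k * ((1 + gaussOrbit ω k) * (1 + 8 * gaussOrbit ω k)) := by
          rw [gaussProd_succ]; ring
      _ ≤ _ := by
          -- With `x = x_k ≤ 1`, `(1 + x)(1 + 8x) = 1 + 9x + 8x² ≤ 1 + 17x`.
          refine mul_le_mul_of_nonneg_left ?_ hb.le
          nlinarith
  · rintro d ⟨m, n, hd, hs⟩ hle
    rcases Nat.eq_zero_or_pos d with rfl | hd0
    · simp
    rw [← Int.natCast_dvd_natCast, ← hd]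
    refine convergentSum_dvd hω h k (by omega) ?_ (by linarith)
    rw [hd]; exact_mod_cast hle
  · rintro d ⟨m, n, hd, hs⟩ d' ⟨m', n', hd', hs'⟩ hlt hle
    rw [← Int.natCast_dvd_natCast, Nat.cast_sub hlt.le,
      show (d' : ℤ) - d = (m' - m) + (n' - n) by rw [← hd, ← hd']; ring]
    refine convergentSum_dvd hω h k (by omega) ?_ ?_
    · rw [show (m' - m) + (n' - n) = (d' : ℤ) - d by rw [← hd, ← hd']; ring]
      push_cast
      exact hle
    -- Each divisor is below a quarter of `gaussProd ω k`, so their difference is below a half, as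
    -- divisibility requires.
    · rw [abs_lt] at hs hs' ⊢
      push_cast
      constructor <;> linarith

end GaussMap

/-! ### The exponent `K` and its comparison with the Bruno function. -/

section Weight

variable {ω : ℝ}

lemma summable_gaussProd (h : Irrational ω) : Summable (gaussProd ω) :=
  summable_of_sum_range_le (fun n => (gaussProd_pos h n).le) (sum_gaussProd_le h)

lemma tsum_gaussProd_le (h : Irrational ω) : ∑' n, gaussProd ω n ≤ 4 :=
  Real.tsum_le_of_sum_range_le (fun n => (gaussProd_pos h n).le) (sum_gaussProd_le h)

lemma log_inv_gaussOrbit_nonneg (h : Irrational ω) (n : ℕ) : 0 ≤ Real.log (1 / gaussOrbit ω n) := by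
  apply Real.log_nonneg
  rw [le_div_iff₀ (gaussOrbit_pos h n), one_mul]
  exact (gaussOrbit_lt_one n).le

lemma gaussOrbit_mul_log_le (h : Irrational ω) (n : ℕ) :
    gaussOrbit ω n * Real.log (1 / gaussOrbit ω n) ≤ 1 := by
  have hx := gaussOrbit_pos h n
  have h1 := Real.log_le_sub_one_of_pos (x := 1 / gaussOrbit ω n) (by positivity)
  calc _ ≤ gaussOrbit ω n * (1 / gaussOrbit ω n) := by gcongr; linarith
    _ = 1 := by field_simp

/-- The contribution of the `k`-th scale to the exponent in the estimate of the coefficients. -/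
noncomputable def scaleWeight (ω : ℝ) (n k : ℕ) : ℝ :=
  maxCount (smallDivisorSet ω k) n * Real.log (1 / gaussOrbit ω k)

/-- The exponent in the estimate of the coefficients of the linearization. -/
noncomputable def divisorWeight (ω : ℝ) (n : ℕ) : ℝ :=
  n * Real.log 4 + ∑' k, scaleWeight ω n k

lemma scaleWeight_nonneg (h : Irrational ω) (n k : ℕ) : 0 ≤ scaleWeight ω n k :=
  mul_nonneg (Nat.cast_nonneg _) (log_inv_gaussOrbit_nonneg h k)

lemma scaleWeight_le (hω : 0 < ω) (h : Irrational ω) (n k : ℕ) :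
    scaleWeight ω n k ≤
      n * (gaussProd ω k * Real.log (1 / gaussOrbit ω k) + 17 * gaussProd ω k) := by
  have hb := (gaussProd_pos h k).le
  calc scaleWeight ω n k
      ≤ n * (gaussProd ω k * (1 + 17 * gaussOrbit ω k)) * Real.log (1 / gaussOrbit ω k) :=
        mul_le_mul_of_nonneg_right (maxCount_smallDivisorSet_le hω h k n)
          (log_inv_gaussOrbit_nonneg h k)
    _ = n * (gaussProd ω k * Real.log (1 / gaussOrbit ω k) +
          17 * gaussProd ω k * (gaussOrbit ω k * Real.log (1 / gaussOrbit ω k))) := by ring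
    _ ≤ n * (gaussProd ω k * Real.log (1 / gaussOrbit ω k) + 17 * gaussProd ω k * 1) := by
        gcongr
        exact gaussOrbit_mul_log_le h k
    _ = _ := by ring

variable (hω : 0 < ω) (h : Irrational ω)
  (hB : Summable fun k => gaussProd ω k * Real.log (1 / gaussOrbit ω k))

include hω h hB

lemma summable_scaleWeight (n : ℕ) : Summable (scaleWeight ω n) :=
  Summable.of_nonneg_of_le (scaleWeight_nonneg h n) (scaleWeight_le hω h n)
    ((hB.add ((summable_gaussProd h).mul_left 17)).mul_left _)

/-- The factor `1 + 17 x_k` costs only a constant because `x log (1/x) ≤ 1`; `68 = 17 · 4`, where 4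
bounds the sum of the products. -/
lemma divisorWeight_le (n : ℕ) : divisorWeight ω n ≤
    n * (Real.log 4 + (∑' k, gaussProd ω k * Real.log (1 / gaussOrbit ω k)) + 68) := by
  have h1 : ∑' k, scaleWeight ω n k ≤ _ :=
    (summable_scaleWeight hω h hB n).tsum_le_tsum (scaleWeight_le hω h n)
    ((hB.add ((summable_gaussProd h).mul_left 17)).mul_left _)
  rw [tsum_mul_left, hB.tsum_add ((summable_gaussProd h).mul_left 17), tsum_mul_left] at h1
  have h2 := mul_le_mul_of_nonneg_left (tsum_gaussProd_le h) (Nat.cast_nonneg (α := ℝ) n)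
  rw [divisorWeight]
  linarith

lemma divisorWeight_add_le (m n : ℕ) :
    divisorWeight ω m + divisorWeight ω n ≤ divisorWeight ω (m + n) := by
  have h1 : ∑' k, (scaleWeight ω m k + scaleWeight ω n k) ≤ ∑' k, scaleWeight ω (m + n) k := by
    refine Summable.tsum_le_tsum (fun k => ?_)
      ((summable_scaleWeight hω h hB m).add (summable_scaleWeight hω h hB n))
      (summable_scaleWeight hω h hB _)
    rw [scaleWeight, scaleWeight, scaleWeight, ← add_mul]
    refine mul_le_mul_of_nonneg_right ?_ (log_inv_gaussOrbit_nonneg h k)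
    exact_mod_cast maxCount_add_le _ m n
  rw [(summable_scaleWeight hω h hB m).tsum_add (summable_scaleWeight hω h hB n)] at h1
  simp only [divisorWeight]
  push_cast
  linarith

omit hω hB in
lemma exists_gaussProd_le {ε : ℝ} (hε : 0 < ε) : ∃ k, gaussProd ω k ≤ ε := by
  obtain ⟨k, hk⟩ := ((summable_gaussProd h).tendsto_atTop_zero.eventually_lt_const hε).exists
  exact ⟨k, hk.le⟩

omit hω hB in
lemma sum_log_inv_gaussOrbit (k : ℕ) :
    ∑ i ∈ Finset.range k, Real.log (1 / gaussOrbit ω i) = -Real.log (gaussProd ω k) := by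
  rw [gaussProd, Real.log_prod (fun i _ => (gaussOrbit_pos h i).ne'), ← Finset.sum_neg_distrib]
  simp

/-- A divisor of size `δ` is small at every scale before the first `k` with `gaussProd ω k / 4 ≤ δ`.
Each of these scales gains one count, and their weights add up to `-log (gaussProd ω k)`. -/
lemma divisorWeight_sub_log_le {d : ℕ} {m n : ℤ} (hd : m + n = d + 1) (h0 : (n * ω - m) ≠ 0) :
    divisorWeight ω d - Real.log |n * ω - m| ≤ divisorWeight ω (d + 1) := by
  have hδ := abs_pos.2 h0
  set δ := |n * ω - m| with hδdef
  have hex : ∃ k, gaussProd ω k / 4 ≤ δ := by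
    obtain ⟨k, hk⟩ := exists_gaussProd_le h (ε := 4 * δ) (by positivity)
    exact ⟨k, by linarith⟩
  classical
  set k := Nat.find hex with hk
  have hkδ : gaussProd ω k / 4 ≤ δ := Nat.find_spec hex
  have hmem : ∀ i ∈ Finset.range k, d + 1 ∈ smallDivisorSet ω i := fun i hi =>
    ⟨m, n, by rw [hd]; push_cast; rfl, not_le.1 (Nat.find_min hex (Finset.mem_range.1 hi))⟩
  have hsum : Summable fun i => if i ∈ Finset.range k then Real.log (1 / gaussOrbit ω i) else 0 :=
    summable_of_ne_finset_zero (s := Finset.range k) fun i hi => by simp [hi]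
  have h1 : ∑' i, (scaleWeight ω d i +
      if i ∈ Finset.range k then Real.log (1 / gaussOrbit ω i) else 0) ≤
      ∑' i, scaleWeight ω (d + 1) i := by
    refine Summable.tsum_le_tsum (fun i => ?_) ((summable_scaleWeight hω h hB d).add hsum)
      (summable_scaleWeight hω h hB _)
    have hl := log_inv_gaussOrbit_nonneg h i
    split_ifs with hi
    · have : ((maxCount (smallDivisorSet ω i) d : ℕ) : ℝ) + 1 ≤
        maxCount (smallDivisorSet ω i) (d + 1) := by
        exact_mod_cast maxCount_succ_le (hmem i hi)
      have := mul_le_mul_of_nonneg_right this hl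
      rw [scaleWeight, scaleWeight]
      linarith
    · have : ((maxCount (smallDivisorSet ω i) d : ℕ) : ℝ) ≤
        maxCount (smallDivisorSet ω i) (d + 1) := by
        exact_mod_cast (Nat.le_add_right _ _).trans (maxCount_add_le _ d 1)
      have := mul_le_mul_of_nonneg_right this hl
      rw [scaleWeight, scaleWeight]
      linarith
  have h3 : ∑' i, (if i ∈ Finset.range k then Real.log (1 / gaussOrbit ω i) else 0) =
      -Real.log (gaussProd ω k) := by
    rw [tsum_eq_sum (s := Finset.range k) (fun i hi => if_neg hi),
      Finset.sum_congr rfl (fun i hi => if_pos hi), sum_log_inv_gaussOrbit h]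
  rw [(summable_scaleWeight hω h hB d).tsum_add hsum, h3] at h1
  -- The loss of the factor 4 is covered by the summand `n log 4` of the weight.
  have h2 := Real.log_le_log (by have := gaussProd_pos h k; positivity) hkδ
  rw [Real.log_div (gaussProd_pos h k).ne' (by norm_num)] at h2
  simp only [divisorWeight]
  push_cast
  linarith

omit hB hω in
lemma divisorWeight_nonneg (n : ℕ) : 0 ≤ divisorWeight ω n :=
  add_nonneg (mul_nonneg n.cast_nonneg (Real.log_nonneg (by norm_num)))
    (tsum_nonneg (scaleWeight_nonneg h n))

lemma divisorWeight_mono : Monotone (divisorWeight ω) :=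
  monotone_nat_of_le_succ fun n => by
    linarith [divisorWeight_add_le hω h hB n 1, divisorWeight_nonneg h 1]

end Weight

/-! ### Formal series in two variables: composition and order. -/

open Finsupp in
/-- The exponents of degree at most `N` of monomials in two variables. -/
noncomputable def degreeLE (N : ℕ) : Finset (Fin 2 →₀ ℕ) :=
  (finite_of_degree_le (σ := Fin 2) N).toFinset

lemma mem_degreeLE {N : ℕ} {α : Fin 2 →₀ ℕ} : α ∈ degreeLE N ↔ α.degree ≤ N := by
  simp [degreeLE]

/-- The monomial `H^β = H_1^{β_1} H_2^{β_2}`. -/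
noncomputable def FormalMap.monomial (H : FormalMap) (β : Fin 2 →₀ ℕ) : MvPowerSeries (Fin 2) ℂ :=
  β.prod fun i e => H i ^ e

lemma FormalMap.monomial_eq (H : FormalMap) (β : Fin 2 →₀ ℕ) :
    H.monomial β = H 0 ^ β 0 * H 1 ^ β 1 := by
  rw [FormalMap.monomial, Finsupp.prod_fintype _ _ (by simp), Fin.prod_univ_two]

lemma degree_fin_two (β : Fin 2 →₀ ℕ) : β.degree = β 0 + β 1 := by
  rw [Finsupp.degree_eq_sum, Fin.sum_univ_two]

/-- A graded property of pairs of series that is multiplicative passes from the components of two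
formal maps to the monomials in these components. -/
lemma FormalMap.monomial_induction
    (P : ℕ → MvPowerSeries (Fin 2) ℂ → MvPowerSeries (Fin 2) ℂ → Prop) (one : P 0 1 1)
    (mul : ∀ {s t f f' g g'}, P s f f' → P t g g' → P (s + t) (f * g) (f' * g'))
    {H H' : FormalMap} (hH : ∀ j, P 1 (H j) (H' j)) (β : Fin 2 →₀ ℕ) :
    P β.degree (H.monomial β) (H'.monomial β) := by
  have pow : ∀ j n, P n (H j ^ n) (H' j ^ n) := by
    intro j n
    induction n with
    | zero => simpa using one
    | succ n ih => simpa only [pow_succ] using mul ih (hH j)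
  rw [degree_fin_two, FormalMap.monomial_eq, FormalMap.monomial_eq]
  exact mul (pow 0 _) (pow 1 _)

section Formal

open MvPowerSeries

lemma coeff_mul_eq_zero_of_degree_lt {s t : ℕ} {f g : MvPowerSeries (Fin 2) ℂ}
    (hf : ∀ α, α.degree < s → coeff α f = 0) (hg : ∀ α, α.degree < t → coeff α g = 0)
    {α : Fin 2 →₀ ℕ} (h : α.degree < s + t) : coeff α (f * g) = 0 := by
  classical
  rw [coeff_mul]
  refine Finset.sum_eq_zero fun p hp => ?_
  rw [Finset.HasAntidiagonal.mem_antidiagonal] at hp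
  rw [← hp, map_add] at h
  rcases lt_or_ge p.1.degree s with h1 | h1
  · rw [hf _ h1, zero_mul]
  · rw [hg _ (by omega), mul_zero]

lemma FormalMap.coeff_monomial_eq_zero {H : FormalMap} (hH : ∀ j, coeff 0 (H j) = 0)
    {α β : Fin 2 →₀ ℕ} (h : α.degree < β.degree) : coeff α (H.monomial β) = 0 := by
  refine FormalMap.monomial_induction (fun s f _ => ∀ α, α.degree < s → coeff α f = 0)
    (by simp) (fun hf hg α h => coeff_mul_eq_zero_of_degree_lt hf hg h) (H' := H)
    (fun j α h => ?_) β α h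
  rw [Nat.lt_one_iff, Finsupp.degree_eq_zero_iff] at h
  rw [h, hH]

lemma hasSubst_of_coeff_zero {H : FormalMap} (hH : ∀ j, coeff 0 (H j) = 0) : HasSubst H :=
  hasSubst_of_constantCoeff_zero fun j => by rw [← hH j, coeff_zero_eq_constantCoeff_apply]

lemma coeff_subst_eq_sum {H : FormalMap} (hH : ∀ j, coeff 0 (H j) = 0)
    (f : MvPowerSeries (Fin 2) ℂ) {α : Fin 2 →₀ ℕ} {N : ℕ} (hα : α.degree ≤ N) :
    coeff α (subst H f) = ∑ β ∈ degreeLE N, coeff β f * coeff α (H.monomial β) := by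
  rw [coeff_subst (hasSubst_of_coeff_zero hH), finsum_eq_sum_of_support_subset]
  · rfl
  · intro β hβ
    rw [Finset.mem_coe, mem_degreeLE]
    by_contra! h
    refine hβ ?_
    change coeff β f • coeff α (H.monomial β) = 0
    rw [FormalMap.coeff_monomial_eq_zero hH (by omega), smul_zero]

/-- Two series of order at least `s` that agree up to degree `N + s`. -/
def AgreeTo (N s : ℕ) (f g : MvPowerSeries (Fin 2) ℂ) : Prop :=
  (∀ α, α.degree < s → coeff α f = 0) ∧ (∀ α, α.degree < s → coeff α g = 0) ∧
    ∀ α, α.degree ≤ N + s → coeff α f = coeff α g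

/-- Counting degrees above the order makes `N` stable under products: if both factors reach their
orders, neither exceeds its own by more than `N`. -/
lemma AgreeTo.mul {N s t : ℕ} {f f' g g' : MvPowerSeries (Fin 2) ℂ} (hf : AgreeTo N s f f')
    (hg : AgreeTo N t g g') : AgreeTo N (s + t) (f * g) (f' * g') := by
  classical
  refine ⟨fun α => coeff_mul_eq_zero_of_degree_lt hf.1 hg.1,
    fun α => coeff_mul_eq_zero_of_degree_lt hf.2.1 hg.2.1, fun α hα => ?_⟩
  rw [coeff_mul, coeff_mul]
  refine Finset.sum_congr rfl fun p hp => ?_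
  rw [Finset.HasAntidiagonal.mem_antidiagonal] at hp
  rw [← hp, map_add] at hα
  rcases lt_or_ge p.1.degree s with h1 | h1
  · rw [hf.1 _ h1, hf.2.1 _ h1, zero_mul, zero_mul]
  rcases lt_or_ge p.2.degree t with h2 | h2
  · rw [hg.1 _ h2, hg.2.1 _ h2, mul_zero, mul_zero]
  rw [hf.2.2 _ (by omega), hg.2.2 _ (by omega)]

/-- One degree of agreement is gained, since only monomials of degree at least 2 occur in `g`. -/
lemma coeff_subst_congr {N : ℕ} {H H' : FormalMap} (hH : ∀ j, AgreeTo N 1 (H j) (H' j))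
    {g : MvPowerSeries (Fin 2) ℂ} (hg : ∀ β, β.degree < 2 → coeff β g = 0) {α : Fin 2 →₀ ℕ}
    (hα : α.degree ≤ N + 2) : coeff α (subst H g) = coeff α (subst H' g) := by
  rw [coeff_subst_eq_sum (fun j => (hH j).1 0 (by simp)) g le_rfl,
    coeff_subst_eq_sum (fun j => (hH j).2.1 0 (by simp)) g le_rfl]
  refine Finset.sum_congr rfl fun β _ => ?_
  rcases lt_or_ge β.degree 2 with h | h
  · rw [hg β h, zero_mul, zero_mul]
  · rw [(FormalMap.monomial_induction (AgreeTo N) ⟨by simp, by simp, by simp⟩ AgreeTo.mul hH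
      β).2.2 α (by omega)]

lemma coeff_X_mul_pderiv (i : Fin 2) (f : MvPowerSeries (Fin 2) ℂ) (α : Fin 2 →₀ ℕ) :
    coeff α (X i * pderiv ℂ i f) = α i * coeff α f := by
  classical
  rcases Nat.eq_zero_or_pos (α i) with h | h
  · rw [h, Nat.cast_zero, zero_mul, coeff_mul]
    refine Finset.sum_eq_zero fun p hp => ?_
    rw [Finset.HasAntidiagonal.mem_antidiagonal] at hp
    rw [coeff_X, if_neg, zero_mul]
    intro h1
    rw [← hp, h1] at h
    simp at h
  · obtain ⟨β, rfl⟩ : ∃ β, α = Finsupp.single i 1 + β :=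
      ⟨α - Finsupp.single i 1, (add_tsub_cancel_of_le (by simpa [Nat.one_le_iff_ne_zero] using h.ne')).symm⟩
    rw [X, coeff_add_monomial_mul, coeff_pderiv, one_mul, add_comm β, mul_comm]
    simp [add_comm]

end Formal

/-! ### Existence and uniqueness of the linearization. -/

section Linearization

open MvPowerSeries

variable {ω : ℝ}

/-- The divisor `⟨λ, α⟩ - λ_j`. -/
noncomputable def divisor (ω : ℝ) (j : Fin 2) (α : Fin 2 →₀ ℕ) : ℂ :=
  ∑ i, eigenvalues ω i * α i - eigenvalues ω j

/-- The sum `m + n` is `|α| - 1` for both components, so a single counting parameter serves for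
both. -/
lemma exists_divisor_eq (ω : ℝ) (j : Fin 2) {α : Fin 2 →₀ ℕ} (hα : 2 ≤ α.degree) :
    ∃ m n : ℤ, m + n = (α.degree - 2 : ℕ) + 1 ∧ divisor ω j α = ((n * ω - m : ℝ) : ℂ) := by
  have hd := degree_fin_two α
  fin_cases j
  · refine ⟨α 0 - 1, α 1, by omega, ?_⟩
    simp [divisor, eigenvalues]
    ring
  · refine ⟨α 0, α 1 - 1, by omega, ?_⟩
    simp [divisor, eigenvalues]
    ring

lemma mul_sub_ne_zero (h : Irrational ω) {m n : ℤ} (hmn : m + n ≠ 0) : n * ω - m ≠ 0 := by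
  intro h0
  rcases eq_or_ne n 0 with rfl | hn
  · apply hmn
    simp only [Int.cast_zero, zero_mul, zero_sub, neg_eq_zero, Int.cast_eq_zero] at h0
    rw [h0, add_zero]
  · exact ((h.intCast_mul hn).sub_intCast m).ne_zero h0

lemma divisor_ne_zero (h : Irrational ω) (j : Fin 2) {α : Fin 2 →₀ ℕ} (hα : 2 ≤ α.degree) :
    divisor ω j α ≠ 0 := by
  obtain ⟨m, n, h1, h2⟩ := exists_divisor_eq ω j hα
  rw [h2]
  exact_mod_cast mul_sub_ne_zero h (by omega : m + n ≠ 0)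

/-- The part of order at least `2` of a formal vector field with linear part `diag(-1, ω)`. -/
noncomputable def nonlinearPart (ω : ℝ) (F : FormalMap) : FormalMap :=
  fun j => F j - eigenvalues ω j • X j

lemma degree_lt_two {β : Fin 2 →₀ ℕ} (h : β.degree < 2) : β = 0 ∨ ∃ i, β = Finsupp.single i 1 := by
  have hd := degree_fin_two β
  have : (β 0 = 0 ∧ β 1 = 0) ∨ (β 0 = 1 ∧ β 1 = 0) ∨ (β 0 = 0 ∧ β 1 = 1) := by omega
  rcases this with h | h | h
  · left; ext i; fin_cases i <;> simp [h.1, h.2]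
  · right; refine ⟨0, ?_⟩; ext i; fin_cases i <;> simp [h.1, h.2]
  · right; refine ⟨1, ?_⟩; ext i; fin_cases i <;> simp [h.1, h.2]

variable {F H H' : FormalMap}

lemma coeff_nonlinearPart_of_degree_lt_two (hF : F ∈ vectorFieldFamily ω) (j : Fin 2)
    {β : Fin 2 →₀ ℕ} (hβ : β.degree < 2) : coeff β (nonlinearPart ω F j) = 0 := by
  classical
  rcases degree_lt_two hβ with rfl | ⟨i, rfl⟩
  · rw [nonlinearPart, map_sub, hF.1 j, map_smul, coeff_zero_X, smul_zero, sub_zero]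
  · rw [nonlinearPart, map_sub, hF.2.1 i j, map_smul, coeff_index_single_X]
    by_cases h : i = j <;> simp [h]

lemma norm_coeff_nonlinearPart_le (hF : F ∈ vectorFieldFamily ω) (j : Fin 2)
    (β : Fin 2 →₀ ℕ) : ‖coeff β (nonlinearPart ω F j)‖ ≤ 1 := by
  classical
  rcases lt_or_ge β.degree 2 with h | h
  · rw [coeff_nonlinearPart_of_degree_lt_two hF j h]; simp
  · rw [nonlinearPart, map_sub, map_smul, coeff_X, if_neg, smul_zero, sub_zero]
    · exact hF.2.2 β j h
    · rintro rfl
      simp at h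

lemma coeff_subst_field (hH : ∀ j, coeff 0 (H j) = 0) (j : Fin 2) (α : Fin 2 →₀ ℕ) :
    coeff α (subst H (F j)) =
      coeff α (subst H (nonlinearPart ω F j)) + eigenvalues ω j * coeff α (H j) := by
  have h := hasSubst_of_coeff_zero hH
  have : F j = nonlinearPart ω F j + eigenvalues ω j • X j := by simp [nonlinearPart]
  conv_lhs => rw [this]
  rw [subst_add h, subst_smul h, subst_X h, map_add, map_smul, smul_eq_mul]

lemma coeff_sum_smul_X_mul_pderiv (j : Fin 2) (f : MvPowerSeries (Fin 2) ℂ) (α : Fin 2 →₀ ℕ) :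
    coeff α (∑ i, (eigenvalues ω i • X i) * pderiv ℂ i f) =
      divisor ω j α * coeff α f + eigenvalues ω j * coeff α f := by
  rw [map_sum, divisor, sub_mul, sub_add_cancel, Finset.sum_mul]
  refine Finset.sum_congr rfl fun i _ => ?_
  rw [smul_mul_assoc, map_smul, coeff_X_mul_pderiv, smul_eq_mul, mul_assoc]

/-- The operator whose fixed points are the linearizations. -/
noncomputable def linearizationStep (ω : ℝ) (F H : FormalMap) : FormalMap := fun j α =>
  if α.degree < 2 then coeff α (X j : MvPowerSeries (Fin 2) ℂ)
  else (divisor ω j α)⁻¹ * coeff α (subst H (nonlinearPart ω F j))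

lemma coeff_linearizationStep (j : Fin 2) (α : Fin 2 →₀ ℕ) :
    coeff α (linearizationStep ω F H j) =
      if α.degree < 2 then coeff α (X j : MvPowerSeries (Fin 2) ℂ)
      else (divisor ω j α)⁻¹ * coeff α (subst H (nonlinearPart ω F j)) := rfl

lemma coeff_zero_linearizationStep (j : Fin 2) : coeff 0 (linearizationStep ω F H j) = 0 := by
  rw [coeff_linearizationStep, if_pos (by simp), coeff_zero_X]

lemma isLinearization_iff (h : Irrational ω) (hF : F ∈ vectorFieldFamily ω) :
    IsLinearization ω F H ↔ linearizationStep ω F H = H := by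
  classical
  constructor
  · intro hH
    funext j
    ext α
    rw [coeff_linearizationStep]
    split_ifs with hα
    · rcases degree_lt_two hα with rfl | ⟨i, rfl⟩
      · rw [hH.coeff_zero, coeff_zero_X]
      · rw [hH.coeff_one, coeff_index_single_X]
    · rw [inv_mul_eq_iff_eq_mul₀ (divisor_ne_zero h j (not_lt.1 hα))]
      have := congrArg (coeff α) (hH.conj j)
      rw [coeff_sum_smul_X_mul_pderiv j, coeff_subst_field (ω := ω) hH.coeff_zero] at this
      exact (add_right_cancel this).symm
  · intro hH
    have hc : ∀ j α, coeff α (H j) = coeff α (linearizationStep ω F H j) :=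
      fun j α => by rw [hH]
    have hX : ∀ j α, α.degree < 2 → coeff α (H j) = coeff α (X j) := fun j α hα => by
      rw [hc, coeff_linearizationStep, if_pos hα]
    have h0 : ∀ j, coeff 0 (H j) = 0 := fun j => by rw [hX j 0 (by simp), coeff_zero_X]
    refine ⟨h0, fun i j => ?_, fun j => ?_⟩
    · rw [hX j _ (by simp), coeff_index_single_X]
    · ext α
      rw [coeff_sum_smul_X_mul_pderiv j, coeff_subst_field (ω := ω) h0, add_left_inj]
      rcases lt_or_ge α.degree 2 with hα | hα
      · rw [coeff_subst_eq_sum h0 _ hα.le, Finset.sum_eq_zero, hX j α hα]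
        -- For `α = e_j` the divisor is `λ_j - λ_j = 0`; for the other `α` the coefficient of `X j`
        -- is 0.
        · rw [coeff_X]
          split_ifs with h1
          · rw [h1, divisor]
            simp [Finsupp.single_apply]
          · rw [mul_zero]
        · intro β hβ
          rcases lt_or_ge β.degree 2 with hβ | hβ
          · rw [coeff_nonlinearPart_of_degree_lt_two hF j hβ, zero_mul]
          · rw [FormalMap.coeff_monomial_eq_zero h0 (by omega), mul_zero]
      · rw [hc, coeff_linearizationStep, if_neg (not_lt.2 hα), mul_inv_cancel_left₀ (divisor_ne_zero h j hα)]

lemma AgreeTo.linearizationStep (hF : F ∈ vectorFieldFamily ω) {N : ℕ}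
    (hH : ∀ j, AgreeTo N 1 (H j) (H' j)) (j : Fin 2) :
    AgreeTo (N + 1) 1 (linearizationStep ω F H j) (linearizationStep ω F H' j) := by
  have h0 : ∀ H : FormalMap, ∀ α : Fin 2 →₀ ℕ, α.degree < 1 →
      coeff α (_root_.linearizationStep ω F H j) = 0 := by
    intro H α hα
    rw [Nat.lt_one_iff, Finsupp.degree_eq_zero_iff] at hα
    rw [hα, coeff_zero_linearizationStep]
  refine ⟨h0 H, h0 H', fun α hα => ?_⟩
  rw [coeff_linearizationStep, coeff_linearizationStep,
    coeff_subst_congr hH (fun β => coeff_nonlinearPart_of_degree_lt_two hF j) (by omega)]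

lemma agreeTo_zero_linearizationStep (j : Fin 2) :
    AgreeTo 0 1 (linearizationStep ω F H j) (linearizationStep ω F H' j) := by
  have h0 : ∀ H : FormalMap, ∀ α : Fin 2 →₀ ℕ, α.degree < 1 →
      coeff α (linearizationStep ω F H j) = 0 := by
    intro H α hα
    rw [Nat.lt_one_iff, Finsupp.degree_eq_zero_iff] at hα
    rw [hα, coeff_zero_linearizationStep]
  refine ⟨h0 H, h0 H', fun α hα => ?_⟩
  rw [coeff_linearizationStep, coeff_linearizationStep, if_pos (by omega), if_pos (by omega)]

/-- The step operator is a contraction for the degree filtration. The fixed point `L` takes its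
coefficients of degree `d` from the `(d+1)`-st iterate, where they no longer depend on the starting
series. -/
lemma existsUnique_linearization (h : Irrational ω) (hF : F ∈ vectorFieldFamily ω) :
    ∃! H : FormalMap, IsLinearization ω F H := by
  simp only [isLinearization_iff h hF]
  have agree : ∀ (N : ℕ) (H H' : FormalMap) (j : Fin 2),
      AgreeTo N 1 ((linearizationStep ω F)^[N + 1] H j) ((linearizationStep ω F)^[N + 1] H' j) := by
    intro N H H'
    induction N with
    | zero => exact fun j => agreeTo_zero_linearizationStep j
    | succ N ih =>
      rw [Function.iterate_succ_apply', Function.iterate_succ_apply' (n := N + 1)]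
      exact AgreeTo.linearizationStep hF ih
  let L : FormalMap := fun j α => coeff α ((linearizationStep ω F)^[α.degree + 1] 0 j)
  have hL : ∀ (N : ℕ) (j : Fin 2) (α : Fin 2 →₀ ℕ), α.degree ≤ N + 1 →
      coeff α (L j) = coeff α ((linearizationStep ω F)^[N + 1] 0 j) := by
    intro N j α hα
    change coeff α ((linearizationStep ω F)^[α.degree + 1] 0 j) = _
    rcases Nat.le_total α.degree N with h1 | h1
    · obtain ⟨t, rfl⟩ := Nat.exists_eq_add_of_le h1
      rw [add_right_comm, Function.iterate_add_apply _ (α.degree + 1) t]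
      exact (agree α.degree 0 _ j).2.2 α (by omega)
    · obtain ⟨t, ht⟩ := Nat.exists_eq_add_of_le h1
      rw [ht, add_right_comm, Function.iterate_add_apply _ (N + 1) t]
      exact (agree N _ 0 j).2.2 α hα
  have hLN : ∀ N j, AgreeTo N 1 (L j) ((linearizationStep ω F)^[N + 1] 0 j) := fun N j =>
    ⟨fun α hα => (hL N j α (by omega)).trans ((agree N 0 0 j).1 α hα), (agree N 0 0 j).1, hL N j⟩
  refine ⟨L, ?_, fun H hH => ?_⟩
  · funext j
    ext α
    rw [(AgreeTo.linearizationStep hF (hLN α.degree) j).2.2 α (by omega),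
      ← Function.iterate_succ_apply' (linearizationStep ω F)]
    exact (hL (α.degree + 1) j α (by omega)).symm
  · funext j
    ext α
    rw [hL α.degree j α (by omega), ← Function.iterate_fixed hH (α.degree + 1)]
    exact (agree α.degree H 0 j).2.2 α (by omega)

end Linearization

/-! ### Majorant estimates with a superadditive weight. -/

section Estimate

open MvPowerSeries

/-- `f` has order at least `s`, and its coefficients of degree at most `N + s`, weighted with
`r^{|α|} e^{-K(|α| - s)}`, have sum at most `M`. -/
def WeightedBound (K : ℕ → ℝ) (r : ℝ) (N s : ℕ) (M : ℝ) (f : MvPowerSeries (Fin 2) ℂ) : Prop :=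
  (∀ α, α.degree < s → coeff α f = 0) ∧
    ∑ α ∈ degreeLE (N + s), ‖coeff α f‖ * (r ^ α.degree * Real.exp (-K (α.degree - s))) ≤ M

lemma sum_antidiagonal_le {A B S : Finset (Fin 2 →₀ ℕ)} {φ : (Fin 2 →₀ ℕ) × (Fin 2 →₀ ℕ) → ℝ}
    (h0 : ∀ p, 0 ≤ φ p) (h : ∀ p, φ p ≠ 0 → p.1 + p.2 ∈ S → p ∈ A ×ˢ B) :
    ∑ α ∈ S, ∑ p ∈ Finset.HasAntidiagonal.antidiagonal α, φ p ≤ ∑ p ∈ A ×ˢ B, φ p := by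
  classical
  rw [← Finset.sum_biUnion]
  · rw [← Finset.sum_filter_ne_zero]
    refine Finset.sum_le_sum_of_subset_of_nonneg (fun p hp => ?_) fun p _ _ => h0 p
    rw [Finset.mem_filter, Finset.mem_biUnion] at hp
    obtain ⟨⟨α, hα, hp⟩, hne⟩ := hp
    rw [Finset.HasAntidiagonal.mem_antidiagonal] at hp
    exact h p hne (hp ▸ hα)
  · intro α _ β _ hne
    rw [Function.onFun, Finset.disjoint_left]
    intro p hp hp'
    rw [Finset.HasAntidiagonal.mem_antidiagonal] at hp hp'
    exact hne (hp.symm.trans hp')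

variable {K : ℕ → ℝ} {r : ℝ}

/-- Submultiplicativity of a weighted `ℓ¹` norm, truncated in degree: superadditivity of `K` splits
the exponential over the two factors. -/
lemma WeightedBound.mul (hK : ∀ m n, K m + K n ≤ K (m + n)) (hr : 0 < r) {N s t : ℕ} {M M' : ℝ}
    {f g : MvPowerSeries (Fin 2) ℂ} (hf : WeightedBound K r N s M f)
    (hg : WeightedBound K r N t M' g) : WeightedBound K r N (s + t) (M * M') (f * g) := by
  classical
  refine ⟨fun α => coeff_mul_eq_zero_of_degree_lt hf.1 hg.1, ?_⟩
  set F : (Fin 2 →₀ ℕ) → ℝ := fun α =>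
    ‖coeff α f‖ * (r ^ α.degree * Real.exp (-K (α.degree - s))) with hF
  set G : (Fin 2 →₀ ℕ) → ℝ := fun α =>
    ‖coeff α g‖ * (r ^ α.degree * Real.exp (-K (α.degree - t))) with hG
  have hF0 : ∀ α, 0 ≤ F α := fun α => by positivity
  have hG0 : ∀ α, 0 ≤ G α := fun α => by positivity
  have hFs : ∀ α, F α ≠ 0 → s ≤ α.degree := fun α h => by
    by_contra! h1
    exact h (by rw [hF]; simp [hf.1 α h1])
  have hGs : ∀ α, G α ≠ 0 → t ≤ α.degree := fun α h => by
    by_contra! h1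
    exact h (by rw [hG]; simp [hg.1 α h1])
  calc ∑ α ∈ degreeLE (N + (s + t)),
        ‖coeff α (f * g)‖ * (r ^ α.degree * Real.exp (-K (α.degree - (s + t))))
      ≤ ∑ α ∈ degreeLE (N + (s + t)), ∑ p ∈ Finset.HasAntidiagonal.antidiagonal α, F p.1 * G p.2 := by
        refine Finset.sum_le_sum fun α _ => ?_
        rw [coeff_mul]
        refine (mul_le_mul_of_nonneg_right (norm_sum_le _ _) (by positivity)).trans ?_
        rw [Finset.sum_mul]
        refine Finset.sum_le_sum fun p hp => ?_
        rw [Finset.HasAntidiagonal.mem_antidiagonal] at hp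
        rw [norm_mul, ← hp, map_add]
        rcases lt_or_ge p.1.degree s with h1 | h1
        · rw [hf.1 _ h1, norm_zero, zero_mul, zero_mul]
          exact mul_nonneg (hF0 _) (hG0 _)
        rcases lt_or_ge p.2.degree t with h2 | h2
        · rw [hg.1 _ h2, norm_zero, mul_zero, zero_mul]
          exact mul_nonneg (hF0 _) (hG0 _)
        have h3 := hK (p.1.degree - s) (p.2.degree - t)
        rw [show p.1.degree - s + (p.2.degree - t) = p.1.degree + p.2.degree - (s + t) by omega]
          at h3
        calc ‖coeff p.1 f‖ * ‖coeff p.2 g‖ * (r ^ (p.1.degree + p.2.degree) *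
              Real.exp (-K (p.1.degree + p.2.degree - (s + t))))
            ≤ ‖coeff p.1 f‖ * ‖coeff p.2 g‖ * (r ^ (p.1.degree + p.2.degree) *
              Real.exp (-K (p.1.degree - s) + -K (p.2.degree - t))) := by
              gcongr
              linarith
          _ = F p.1 * G p.2 := by
              rw [hF, hG, Real.exp_add, pow_add]
              ring
    _ ≤ ∑ p ∈ degreeLE (N + s) ×ˢ degreeLE (N + t), F p.1 * G p.2 := by
        refine sum_antidiagonal_le (φ := fun p => F p.1 * G p.2)
          (fun p => mul_nonneg (hF0 _) (hG0 _)) fun p hp hS => ?_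
        have h1 := hFs _ (left_ne_zero_of_mul hp)
        have h2 := hGs _ (right_ne_zero_of_mul hp)
        rw [mem_degreeLE, map_add] at hS
        rw [Finset.mem_product, mem_degreeLE, mem_degreeLE]
        omega
    _ = (∑ α ∈ degreeLE (N + s), F α) * ∑ α ∈ degreeLE (N + t), G α := by
        rw [Finset.sum_product, Finset.sum_mul_sum]
    _ ≤ M * M' := by
        have h1 : 0 ≤ ∑ α ∈ degreeLE (N + t), G α := Finset.sum_nonneg fun α _ => hG0 α
        have h2 : 0 ≤ ∑ α ∈ degreeLE (N + s), F α := Finset.sum_nonneg fun α _ => hF0 α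
        exact mul_le_mul hf.2 hg.2 h1 (h2.trans hf.2)

lemma weightedBound_one (hK0 : K 0 = 0) (N : ℕ) : WeightedBound K r N 0 1 1 := by
  classical
  refine ⟨by simp, ?_⟩
  rw [Finset.sum_eq_single 0]
  · simp [hK0]
  · intro α _ h
    rw [coeff_one, if_neg h, norm_zero, zero_mul]
  · simp [mem_degreeLE]

lemma WeightedBound.monomial (hK : ∀ m n, K m + K n ≤ K (m + n)) (hK0 : K 0 = 0) (hr : 0 < r)
    {N : ℕ} {ρ : ℝ} {H : FormalMap} (hH : ∀ j, WeightedBound K r N 1 ρ (H j))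
    (β : Fin 2 →₀ ℕ) : WeightedBound K r N β.degree (ρ ^ β.degree) (H.monomial β) := by
  refine FormalMap.monomial_induction (fun s f _ => WeightedBound K r N s (ρ ^ s) f) ?_ ?_
    (H' := H) ?_ β
  · simpa using weightedBound_one hK0 N
  · intro s t f f' g g' h1 h2
    rw [pow_add]
    exact h1.mul hK hr h2
  · simpa using hH

/-- Two factors `ρ` are kept and the others are replaced by `1/2`; the double geometric series
contributes `2 · 2`. -/
lemma sum_pow_degree_le (N : ℕ) {ρ : ℝ} (hρ : 0 ≤ ρ) (hρ' : ρ ≤ 1 / 2) :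
    ∑ β ∈ (degreeLE N).filter (fun β => 2 ≤ β.degree), ρ ^ β.degree ≤ 16 * ρ ^ 2 := by
  have h1 : ∀ β : Fin 2 →₀ ℕ, 2 ≤ β.degree →
      ρ ^ β.degree ≤ 4 * ρ ^ 2 * ((1 / 2) ^ β 0 * (1 / 2) ^ β 1) := by
    intro β hβ
    rw [← pow_add, ← degree_fin_two]
    obtain ⟨t, ht⟩ := Nat.exists_eq_add_of_le hβ
    rw [ht, pow_add, pow_add]
    have := pow_le_pow_left₀ hρ hρ' t
    nlinarith [sq_nonneg ρ]
  have h2 : ∑ i ∈ Finset.range (N + 1), (1 / 2 : ℝ) ^ i ≤ 2 := sum_geometric_two_le _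
  have h3 : ∑ β ∈ degreeLE N, ((1 / 2 : ℝ) ^ β 0 * (1 / 2) ^ β 1) ≤
      ∑ p ∈ Finset.range (N + 1) ×ˢ Finset.range (N + 1), ((1 / 2 : ℝ) ^ p.1 * (1 / 2) ^ p.2) := by
    classical
    rw [← Finset.sum_image (s := degreeLE N) (g := fun β => (β 0, β 1))
      (f := fun p : ℕ × ℕ => ((1 / 2 : ℝ) ^ p.1 * (1 / 2) ^ p.2))]
    · refine Finset.sum_le_sum_of_subset_of_nonneg (fun p hp => ?_) fun p _ _ => by positivity
      obtain ⟨β, hβ, rfl⟩ := Finset.mem_image.1 hp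
      rw [mem_degreeLE, degree_fin_two] at hβ
      simp only [Finset.mem_product, Finset.mem_range]
      omega
    · intro α _ β _ h
      simp only [Prod.mk.injEq] at h
      ext i
      fin_cases i
      exacts [h.1, h.2]
  rw [Finset.sum_product, ← Finset.sum_mul_sum] at h3
  have h4 : 0 ≤ ∑ i ∈ Finset.range (N + 1), (1 / 2 : ℝ) ^ i :=
    Finset.sum_nonneg fun i _ => by positivity
  calc ∑ β ∈ (degreeLE N).filter (fun β => 2 ≤ β.degree), ρ ^ β.degree
      ≤ ∑ β ∈ (degreeLE N).filter (fun β => 2 ≤ β.degree),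
          4 * ρ ^ 2 * ((1 / 2) ^ β 0 * (1 / 2) ^ β 1) :=
        Finset.sum_le_sum fun β hβ => h1 β (Finset.mem_filter.1 hβ).2
    _ ≤ ∑ β ∈ degreeLE N, 4 * ρ ^ 2 * ((1 / 2) ^ β 0 * (1 / 2) ^ β 1) :=
        Finset.sum_le_sum_of_subset_of_nonneg (Finset.filter_subset _ _)
          fun β _ _ => by positivity
    _ = 4 * ρ ^ 2 * ∑ β ∈ degreeLE N, ((1 / 2 : ℝ) ^ β 0 * (1 / 2) ^ β 1) := by
        rw [Finset.mul_sum]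
    _ ≤ 4 * ρ ^ 2 * (2 * 2) := by
        refine mul_le_mul_of_nonneg_left (h3.trans ?_) (by positivity)
        exact mul_le_mul h2 h2 h4 (by norm_num)
    _ = _ := by ring

lemma sum_degree_lt_two_le (hK0 : K 0 = 0) (hr : 0 < r) {H : FormalMap} {j : Fin 2}
    (hH : ∀ α, α.degree < 2 → coeff α (H j) = coeff α (X j)) (N : ℕ) :
    ∑ α ∈ (degreeLE N).filter (fun α => ¬ 2 ≤ α.degree),
      ‖coeff α (H j)‖ * (r ^ α.degree * Real.exp (-K (α.degree - 1))) ≤ r := by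
  classical
  calc _ ≤ ∑ α ∈ (degreeLE N).filter (fun α => ¬ 2 ≤ α.degree),
        if α = Finsupp.single j 1 then r else 0 := by
        refine Finset.sum_le_sum fun α hα => ?_
        rw [hH α (not_le.1 (Finset.mem_filter.1 hα).2), coeff_X]
        split_ifs with h
        · simp [h, hK0]
        · simp
    _ ≤ r := by
        rw [Finset.sum_ite_eq']
        split_ifs
        exacts [le_rfl, hr.le]

/-- Induction on the truncation degree: monomials of degree at least 2 call on `H` only one degree
lower. With `r = 1/200` and `ρ = 1/100`, the induction closes because `r + 16 ρ² ≤ ρ`. -/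
lemma weightedBound_linearization (hK : ∀ m n, K m + K n ≤ K (m + n)) (hK0 : K 0 = 0)
    (hmono : Monotone K) {H : FormalMap}
    (hH1 : ∀ j α, α.degree < 2 → coeff α (H j) = coeff α (X j))
    (hH2 : ∀ (j : Fin 2) (α : Fin 2 →₀ ℕ), 2 ≤ α.degree →
      ‖coeff α (H j)‖ * Real.exp (-K (α.degree - 1)) ≤ Real.exp (-K (α.degree - 2)) *
        ∑ β ∈ (degreeLE α.degree).filter (fun β => 2 ≤ β.degree), ‖coeff α (H.monomial β)‖)
    (N : ℕ) (j : Fin 2) : WeightedBound K (1 / 200) N 1 (1 / 100) (H j) := by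
  have hr : (0 : ℝ) < 1 / 200 := by norm_num
  have h0 : ∀ j α, α.degree < 1 → coeff α (H j) = 0 := by
    intro j α hα
    rw [hH1 j α (by omega)]
    rw [Nat.lt_one_iff, Finsupp.degree_eq_zero_iff] at hα
    rw [hα, coeff_zero_X]
  induction N generalizing j with
  | zero =>
    refine ⟨h0 j, ?_⟩
    rw [← Finset.sum_filter_add_sum_filter_not _ (fun α : Fin 2 →₀ ℕ => 2 ≤ α.degree),
      Finset.sum_eq_zero (s := Finset.filter (fun α : Fin 2 →₀ ℕ => 2 ≤ α.degree) _)]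
    · have := sum_degree_lt_two_le hK0 hr (hH1 j) (0 + 1)
      linarith
    · intro α hα
      rw [Finset.mem_filter, mem_degreeLE] at hα
      omega
  | succ N ih =>
    refine ⟨h0 j, ?_⟩
    rw [← Finset.sum_filter_add_sum_filter_not _ (fun α : Fin 2 →₀ ℕ => 2 ≤ α.degree)]
    have hlow := sum_degree_lt_two_le hK0 hr (hH1 j) (N + 1 + 1)
    set S := (degreeLE (N + 1 + 1)).filter (fun α : Fin 2 →₀ ℕ => 2 ≤ α.degree) with hS
    have hhigh : ∑ α ∈ S,
        ‖coeff α (H j)‖ * ((1 / 200) ^ α.degree * Real.exp (-K (α.degree - 1))) ≤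
        16 * (1 / 100) ^ 2 := by
      calc _ ≤ ∑ α ∈ S, ∑ β ∈ S, ‖coeff α (H.monomial β)‖ *
            ((1 / 200) ^ α.degree * Real.exp (-K (α.degree - β.degree))) := by
            refine Finset.sum_le_sum fun α hα => ?_
            rw [hS, Finset.mem_filter, mem_degreeLE] at hα
            have h1 := mul_le_mul_of_nonneg_left (hH2 j α hα.2)
              (by positivity : (0 : ℝ) ≤ (1 / 200) ^ α.degree)
            calc _ = (1 / 200) ^ α.degree * (‖coeff α (H j)‖ * Real.exp (-K (α.degree - 1))) := by
                  ring
              _ ≤ _ := h1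
              _ = ∑ β ∈ (degreeLE α.degree).filter (fun β => 2 ≤ β.degree),
                  ‖coeff α (H.monomial β)‖ *
                    ((1 / 200) ^ α.degree * Real.exp (-K (α.degree - 2))) := by
                  rw [← Finset.sum_mul]; ring
              _ ≤ ∑ β ∈ (degreeLE α.degree).filter (fun β => 2 ≤ β.degree),
                  ‖coeff α (H.monomial β)‖ *
                    ((1 / 200) ^ α.degree * Real.exp (-K (α.degree - β.degree))) := by
                  refine Finset.sum_le_sum fun β hβ => ?_
                  gcongr
                  -- Since `|β| ≥ 2`, the weight at `|α| - 2` dominates the one at `|α| - |β|`, the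
                  -- natural weight for a monomial of order `|β|`.
                  exact hmono (by have := (Finset.mem_filter.1 hβ).2; omega)
              _ ≤ _ := by
                  refine Finset.sum_le_sum_of_subset_of_nonneg (fun β hβ => ?_)
                    fun β _ _ => by positivity
                  rw [Finset.mem_filter, mem_degreeLE] at hβ
                  rw [hS, Finset.mem_filter, mem_degreeLE]
                  omega
        _ = ∑ β ∈ S, ∑ α ∈ S, ‖coeff α (H.monomial β)‖ *
            ((1 / 200) ^ α.degree * Real.exp (-K (α.degree - β.degree))) := Finset.sum_comm
        _ ≤ ∑ β ∈ S, (1 / 100) ^ β.degree := by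
            refine Finset.sum_le_sum fun β hβ => ?_
            rw [hS, Finset.mem_filter, mem_degreeLE] at hβ
            refine le_trans ?_ (WeightedBound.monomial hK hK0 hr ih β).2
            refine Finset.sum_le_sum_of_subset_of_nonneg (fun α hα => ?_)
              fun α _ _ => by positivity
            rw [hS, Finset.mem_filter, mem_degreeLE] at hα
            rw [mem_degreeLE]
            omega
        _ ≤ _ := sum_pow_degree_le _ (by norm_num) (by norm_num)
    linarith

end Estimate

/-! ### Convergence of the linearization and the bound on its domain. -/

section Main

open MvPowerSeries

variable {ω : ℝ} {F H : FormalMap}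

lemma norm_coeff_linearization_mul_exp_le (hω : 0 < ω) (h : Irrational ω)
    (hB : Summable fun k => gaussProd ω k * Real.log (1 / gaussOrbit ω k))
    (hF : F ∈ vectorFieldFamily ω) (hH : IsLinearization ω F H) (j : Fin 2) {α : Fin 2 →₀ ℕ}
    (hα : 2 ≤ α.degree) :
    ‖coeff α (H j)‖ * Real.exp (-divisorWeight ω (α.degree - 1)) ≤
      Real.exp (-divisorWeight ω (α.degree - 2)) *
        ∑ β ∈ (degreeLE α.degree).filter (fun β => 2 ≤ β.degree), ‖coeff α (H.monomial β)‖ := by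
  obtain ⟨m, n, hmn, hdiv⟩ := exists_divisor_eq ω j hα
  have hne := mul_sub_ne_zero h (by omega : m + n ≠ 0)
  have hw := divisorWeight_sub_log_le hω h hB hmn hne
  rw [show α.degree - 2 + 1 = α.degree - 1 by omega] at hw
  have hc : coeff α (H j) = (divisor ω j α)⁻¹ * coeff α (subst H (nonlinearPart ω F j)) := by
    conv_lhs => rw [← (isLinearization_iff h hF).1 hH]
    rw [coeff_linearizationStep, if_neg (not_lt.2 hα)]
  have hsum : ‖coeff α (subst H (nonlinearPart ω F j))‖ ≤
      ∑ β ∈ (degreeLE α.degree).filter (fun β => 2 ≤ β.degree), ‖coeff α (H.monomial β)‖ := by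
    rw [coeff_subst_eq_sum hH.coeff_zero _ le_rfl, Finset.sum_filter]
    refine (norm_sum_le _ _).trans (Finset.sum_le_sum fun β _ => ?_)
    split_ifs with hβ
    · rw [norm_mul]
      exact mul_le_of_le_one_left (norm_nonneg _) (norm_coeff_nonlinearPart_le hF j β)
    · rw [coeff_nonlinearPart_of_degree_lt_two hF j (not_le.1 hβ), zero_mul, norm_zero]
  have hdn : ‖(divisor ω j α)⁻¹‖ = Real.exp (-Real.log |n * ω - m|) := by
    rw [hdiv, norm_inv, Complex.norm_real, Real.norm_eq_abs, Real.exp_neg,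
      Real.exp_log (abs_pos.2 hne)]
  rw [hc, norm_mul, hdn, mul_right_comm, ← Real.exp_add]
  refine mul_le_mul ?_ hsum (norm_nonneg _) (Real.exp_pos _).le
  exact Real.exp_le_exp.2 (by linarith)

lemma summable_norm_of_le (hω : 0 < ω) (h : Irrational ω)
    (hB : Summable fun k => gaussProd ω k * Real.log (1 / gaussOrbit ω k))
    (hF : F ∈ vectorFieldFamily ω) (hH : IsLinearization ω F H) {L : ℝ} (hL : 0 ≤ L)
    (hKL : ∀ n : ℕ, divisorWeight ω n ≤ n * L) {z : Fin 2 → ℂ}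
    (hz : ∀ i, ‖z i‖ ≤ 1 / 200 * Real.exp (-L)) (j : Fin 2) :
    Summable fun α : Fin 2 →₀ ℕ => ‖coeff α (H j) * ∏ i, z i ^ α i‖ := by
  have hK0 : divisorWeight ω 0 = 0 :=
    le_antisymm (by simpa using hKL 0) (divisorWeight_nonneg h 0)
  have hH1 : ∀ j α, α.degree < 2 → coeff α (H j) = coeff α (X j) := by
    intro j α hα
    conv_lhs => rw [← (isLinearization_iff h hF).1 hH]
    rw [coeff_linearizationStep, if_pos hα]
  have key := weightedBound_linearization (divisorWeight_add_le hω h hB) hK0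
    (divisorWeight_mono hω h hB) hH1
    (fun j _ => norm_coeff_linearization_mul_exp_le hω h hB hF hH j)
  refine summable_of_sum_le (c := 1 / 100) (fun _ => norm_nonneg _) fun u => ?_
  refine le_trans ?_ (key (u.sup Finsupp.degree) j).2
  refine le_trans (Finset.sum_le_sum fun α _ => ?_)
    (Finset.sum_le_sum_of_subset_of_nonneg (fun α hα => ?_) fun α _ _ => by positivity)
  · rw [norm_mul]
    refine mul_le_mul_of_nonneg_left ?_ (norm_nonneg _)
    calc ‖∏ i, z i ^ α i‖ ≤ (1 / 200 * Real.exp (-L)) ^ α.degree := by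
          rw [norm_prod, degree_fin_two, Fin.prod_univ_two, pow_add, norm_pow, norm_pow]
          gcongr <;> exact hz _
      _ = (1 / 200) ^ α.degree * Real.exp (-(α.degree * L)) := by
          rw [mul_pow, ← Real.exp_nat_mul]
          congr 2
          ring
      _ ≤ _ := by
          gcongr
          refine (hKL _).trans (mul_le_mul_of_nonneg_right ?_ hL)
          exact_mod_cast Nat.sub_le _ _
  · rw [mem_degreeLE]
    exact (Finset.le_sup (f := Finsupp.degree) hα).trans (Nat.le_succ _)

/-- The Euclidean ball of radius `R` lies in the polydisk of radius `R`. If the domain is all of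
`ℂ²` its frontier is empty and the distance is infinite. -/
lemma le_boundaryDistance {R : ℝ} (hR : 0 < R)
    (h : ∀ z : EuclideanSpace ℂ (Fin 2), (∀ i, ‖z i‖ ≤ R) →
      ∀ j, Summable fun α : Fin 2 →₀ ℕ => ‖coeff α (H j) * ∏ i, z i ^ α i‖) :
    ENNReal.ofReal R ≤ boundaryDistance H := by
  have hball : Metric.ball 0 R ⊆ reinhardtDomain H := by
    refine interior_maximal (fun z hz => h z fun i => ?_) Metric.isOpen_ball
    rw [mem_ball_zero_iff] at hz
    exact (PiLp.norm_apply_le z i).trans hz.le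
  rw [boundaryDistance, if_pos (hball (Metric.mem_ball_self hR)), Metric.le_infEDist]
  intro z hz
  rw [edist_dist, dist_zero_left]
  refine ENNReal.ofReal_le_ofReal ?_
  by_contra! hlt
  have hmem := hball (mem_ball_zero_iff.2 hlt)
  rw [reinhardtDomain] at hmem
  rw [reinhardtDomain, isOpen_interior.frontier_eq] at hz
  exact hz.2 hmem

lemma bruno_term_nonneg (h : Irrational ω) (k : ℕ) :
    0 ≤ gaussProd ω k * Real.log (1 / gaussOrbit ω k) :=
  mul_nonneg (gaussProd_pos h k).le (log_inv_gaussOrbit_nonneg h k)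

lemma brunoFunction_eq (ω : ℝ) : brunoFunction ω =
    ∑' k, ENNReal.ofReal (gaussProd ω k * Real.log (1 / gaussOrbit ω k)) := rfl

lemma summable_bruno_term (h : Irrational ω) (hB : brunoFunction ω ≠ ⊤) :
    Summable fun k => gaussProd ω k * Real.log (1 / gaussOrbit ω k) := by
  rw [brunoFunction_eq] at hB
  refine (ENNReal.summable_toReal hB).congr fun k => ?_
  exact ENNReal.toReal_ofReal (bruno_term_nonneg h k)

lemma le_log_dOmega (hω : 0 < ω) (h : Irrational ω) :
    ENNReal.log (dOmega ω) ≥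
      -(brunoFunction ω : EReal) - ((Real.log 4 + 68 + Real.log 200 : ℝ) : EReal) := by
  -- If the Bruno function is infinite the right side is `-∞`.
  rcases eq_or_ne (brunoFunction ω) ⊤ with hB | hB
  · rw [hB]
    simp
  have hs := summable_bruno_term h hB
  set B := ∑' k, gaussProd ω k * Real.log (1 / gaussOrbit ω k) with hBdef
  have hB0 : 0 ≤ B := tsum_nonneg (bruno_term_nonneg h)
  have hBeq : (brunoFunction ω : EReal) = (B : EReal) := by
    rw [brunoFunction_eq, ← ENNReal.ofReal_tsum_of_nonneg (bruno_term_nonneg h) hs,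
      EReal.coe_ennreal_ofReal, max_eq_left hB0]
  set L := Real.log 4 + B + 68 with hLdef
  have hL : 0 ≤ L := by
    have := Real.log_nonneg (by norm_num : (1 : ℝ) ≤ 4)
    linarith
  have hR : 0 < 1 / 200 * Real.exp (-L) := by positivity
  have hd : ENNReal.ofReal (1 / 200 * Real.exp (-L)) ≤ dOmega ω :=
    le_iInf₂ fun F hF => le_iInf₂ fun H hH => le_boundaryDistance hR fun z hz =>
      summable_norm_of_le hω h hs hF hH hL (divisorWeight_le hω h hs) hz
  refine le_trans (le_of_eq ?_) (ENNReal.log_le_log hd)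
  rw [ENNReal.log_ofReal_of_pos hR, hBeq, Real.log_mul (by norm_num) (Real.exp_pos _).ne',
    Real.log_exp, ← EReal.coe_neg, ← EReal.coe_sub, EReal.coe_eq_coe_iff, one_div, Real.log_inv]
  ring

end Main

theorem mainTheorem3 :
    (∀ ω : ℝ, 0 < ω → IsBrunoNumber ω →
      ∀ F ∈ vectorFieldFamily ω, ∃! H : FormalMap, IsLinearization ω F H) ∧
    ∃ C : ℝ, ∀ ω : ℝ, 0 < ω → IsBrunoNumber ω →
      ENNReal.log (dOmega ω) ≥ -(brunoFunction ω : EReal) - (C : EReal) :=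
  ⟨fun _ _ hω _ hF => existsUnique_linearization hω.1 hF,
    Real.log 4 + 68 + Real.log 200, fun _ hpos hω => le_log_dOmega hpos hω.1⟩
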